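/- Let $N\ge 0$ be an integer, let $M(N)$ be the space of complex $N\times N$ matrices, and let $T:M(N)\to M(N)$ be a positive operator, i.e. a $\mathbb{C}$-linear map with $T(X)\succeq 0$ whenever $X\succeq 0$. Put $$\mathrm{Cap}(T)=\inf\{\det T(X) : X\in M(N),\ X\succ 0,\ \det X=1\}.$$ Then $T$ is rank non-decreasing, i.e. $\mathrm{rank}\,T(X)\ge \mathrm{rank}\,X$ for every $X\succeq 0$, if and only if $\mathrm{Cap}(T)>0$. Moreover, for a unitary matrix $U$ with columns $u_1,\dots,u_N$ let $A_{T,U}=(T(u_1u_1^{\dagger}),\dots,T(u_Nu_N^{\dagger}))$, and let $$M(Q_1,\dots,Q_N)=\sum_{\sigma,\tau\in S_N}\mathrm{sign}(\sigma\tau)\prod_{i=1}^N Q_i(\sigma(i),\tau(i))$$ denote the mixed discriminant. Then each $M(A_{T,U})$ is a real number, the minimum of $M(A_{T,U})$ over all unitary $N\times N$ matrices $U$ is attained, and $$\min_{U} M(A_{T,U})\ \le\ \mathrm{Cap}(T)\ \le\ \frac{N^N}{N!}\,\min_{U} M(A_{T,U}),$$ where $0^0=1$. -/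

import Mathlib

open scoped ComplexOrder

/-- A complex-linear operator `T : M(N) → M(N)` is positive if it maps positive semidefinite
matrices to positive semidefinite matrices. -/
def IsPositiveOperator {N : ℕ}
    (T : Matrix (Fin N) (Fin N) ℂ →ₗ[ℂ] Matrix (Fin N) (Fin N) ℂ) : Prop :=
  ∀ X : Matrix (Fin N) (Fin N) ℂ, X.PosSemidef → (T X).PosSemidef

/-- `T` is rank non-decreasing if `Rank (T X) ≥ Rank X` for every positive semidefinite `X`. -/
def IsRankNonDecreasing {N : ℕ}
    (T : Matrix (Fin N) (Fin N) ℂ →ₗ[ℂ] Matrix (Fin N) (Fin N) ℂ) : Prop :=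
  ∀ X : Matrix (Fin N) (Fin N) ℂ, X.PosSemidef → X.rank ≤ (T X).rank

/-- The capacity `Cap T = inf {det (T X) : X ≻ 0, det X = 1}`. For a positive operator `T` each
`det (T X)` is a nonnegative real number, so taking the real part loses nothing, and the set is
nonempty (it contains the value at `X = 1`) and bounded below by `0`. -/
noncomputable def operatorCapacity {N : ℕ}
    (T : Matrix (Fin N) (Fin N) ℂ →ₗ[ℂ] Matrix (Fin N) (Fin N) ℂ) : ℝ :=
  sInf {c : ℝ | ∃ X : Matrix (Fin N) (Fin N) ℂ, X.PosDef ∧ X.det = 1 ∧ c = (T X).det.re}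

/-- The mixed discriminant
`M(Q₁, …, Q_N) = ∑_{σ, τ ∈ S_N} sign(σ τ) ∏ᵢ Qᵢ(σ(i), τ(i))`, that is, the coefficient
of `x₁ ⋯ x_N` in `det (x₁ Q₁ + ⋯ + x_N Q_N)`. -/
noncomputable def mixedDiscriminant {N : ℕ} (Q : Fin N → Matrix (Fin N) (Fin N) ℂ) : ℂ :=
  ∑ σ : Equiv.Perm (Fin N), ∑ τ : Equiv.Perm (Fin N),
    ((Equiv.Perm.sign (σ * τ) : ℤ) : ℂ) * ∏ i : Fin N, Q i (σ i) (τ i)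

/-- The tuple `A_{T,U} = (T (u₁ u₁†), …, T (u_N u_N†))`, where `uᵢ` is the `i`-th column of the
unitary matrix `U`, so that `u₁, …, u_N` runs over all orthonormal bases of `ℂ^N`. -/
noncomputable def decoheredTuple {N : ℕ}
    (T : Matrix (Fin N) (Fin N) ℂ →ₗ[ℂ] Matrix (Fin N) (Fin N) ℂ)
    (U : Matrix.unitaryGroup (Fin N) ℂ) : Fin N → Matrix (Fin N) (Fin N) ℂ :=
  fun i => T (Matrix.vecMulVec (fun j => (U : Matrix (Fin N) (Fin N) ℂ) j i)
    (fun j => star ((U : Matrix (Fin N) (Fin N) ℂ) j i)))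

/-!
For a tuple `A` of positive semidefinite matrices write `M(A)` for the mixed discriminant and
`Cap(A) = inf {det (∑ xᵢ Aᵢ) : x > 0, ∏ xᵢ = 1}`. By the spectral theorem every `X ≻ 0` of
determinant `1` is `U diag(x) U†` with `∏ xᵢ = 1`, and `T X = ∑ xᵢ T(uᵢ uᵢ†)`, so `Cap(T)` is the
infimum over unitary `U` of the capacities of the tuples `A_{T,U}`. The two-sided bound thus follows
from `M(A) ≤ Cap(A) ≤ N ^ N / N! * M(A)` for every tuple, and the minimum over `U` is attained since
the unitary group is compact.

The left inequality (`prod_mul_mixedDiscriminant_le_det`) holds because `N! det (∑ xᵢ Aᵢ)` is the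
sum over all maps `f` of `∏ x_{f i} M(A ∘ f)`, where every mixed discriminant is nonnegative, being
a sum of squared absolute values of determinants (`mixedDiscriminant_eq_sum_det`).

The right inequality is Gurvits' theorem (`le_mixedDiscriminant`). After a perturbation the `Aᵢ` are
positive definite, and then the polynomial `p = det (∑ xᵢ Aᵢ)` has no zeros with all `Re zᵢ ≥ 0` and
some `Re zᵢ > 0`. This property is inherited by `∂p/∂x₀` at `x₀ = 0`, and by homogeneity it forces
the restriction of `p` to one variable, the others being positive, to have negative real roots only.
The arithmetic-geometric mean inequality then bounds the loss of capacity when one variable is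
differentiated away by the factor `((k - 1) / k) ^ (k - 1)`, and the product of these factors is
`N! / N ^ N`; what remains at the end is the coefficient `M(A)` of `∏ xᵢ`.

For the rank criterion, the bounds show that `Cap(T) > 0` if and only if `M(A_{T,U}) > 0` for
all `U`. If `T` is rank non-decreasing, the partial sums of `A_{T,U}` over index sets `S` have rank
at least `|S|`, which makes the capacity of the tuple positive (`exists_pos_mul_prod_le_det`), and
hence also `M(A_{T,U})`. Conversely, if `M(A_{T,U}) ≠ 0` for a `U` diagonalizing `X`, there are
linearly independent vectors in the ranges of the `T(uᵢ uᵢ†)`, and those belonging to nonzero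
eigenvalues of `X` lie in the range of `T X` (`card_le_rank_of_mixedDiscriminant_ne_zero`).
-/

open Matrix

/-! ### Polynomials in one variable with negative roots -/

open Polynomial in
theorem Polynomial.coeff_prod_one_add_C_mul_X (a : Multiset ℂ) :
    ((a.map fun x => 1 + C x * X).prod).coeff 0 = 1 ∧
      ((a.map fun x => 1 + C x * X).prod).coeff 1 = a.sum := by
  induction a using Multiset.induction_on with
  | empty => simp [coeff_one]
  | cons x a ih =>
    obtain ⟨h0, h1⟩ := ih
    constructor
    · simp [add_mul, mul_assoc, h0]
    · simp [add_mul, mul_assoc, h0, h1, coeff_X_mul, add_comm]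

open Polynomial in
/-- The factorization of a polynomial normalized at `0`: `R = R(0) ∏ (1 - X / r)` over the roots. -/
theorem Polynomial.eq_C_mul_prod_one_add {R : ℂ[X]} (h0 : R.eval 0 ≠ 0) :
    R = C (R.eval 0) * ((R.roots.map fun r => -r⁻¹).map fun x => 1 + C x * X).prod := by
  have hs := (IsAlgClosed.splits R).eq_prod_roots
  have hr : ∀ r ∈ R.roots, r ≠ 0 := by
    rintro r hr rfl
    exact h0 (isRoot_of_mem_roots hr)
  have key : ∀ a : Multiset ℂ, (∀ r ∈ a, r ≠ 0) →
      (a.map fun r => X - C r).prod =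
        C ((a.map fun r => -r).prod) * ((a.map fun r => -r⁻¹).map fun x => 1 + C x * X).prod := by
    intro a
    induction a using Multiset.induction_on with
    | empty => simp
    | cons r a ih =>
      intro ha
      have hr0 : r ≠ 0 := ha r (by simp)
      have h1 : X - C r = C (-r) * (1 + C (-r⁻¹) * X) := by
        rw [mul_add, ← mul_assoc, ← C_mul, neg_mul_neg, mul_inv_cancel₀ hr0]
        simp; ring
      simp only [Multiset.map_cons, Multiset.prod_cons]
      rw [ih (fun r hr => ha r (by simp [hr])), h1, C_mul]
      ring
  have he : R.eval 0 = R.leadingCoeff * (R.roots.map fun r => -r).prod := by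
    rw [(IsAlgClosed.splits R).eval_eq_prod_roots]; simp
  rw [key _ hr, ← mul_assoc, ← C_mul, ← he] at hs
  exact hs

/-- The arithmetic-geometric mean inequality for the numbers `1 + x`, where up to `n - card a`
factors `1` are added to reach `n` factors. -/
theorem Multiset.prod_le_pow_of_sum_le (n : ℕ) (a : Multiset ℝ) (ha : ∀ x ∈ a, 0 ≤ x)
    (hn : a.card ≤ n) (hpos : 0 < n) :
    (a.map fun x => 1 + x).prod ≤ (1 + a.sum / n) ^ n := by
  have hs : 0 ≤ a.sum := Multiset.sum_nonneg ha
  have hn' : (0 : ℝ) < n := by exact_mod_cast hpos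
  set c : ℝ := 1 + a.sum / n with hc
  have hc1 : 1 ≤ c := by
    have : 0 ≤ a.sum / n := by positivity
    linarith
  have hc0 : 0 < c := by linarith
  -- the tangent line bound `y ≤ c * exp (y / c - 1)`, multiplied over all factors
  have key : ∀ b : Multiset ℝ, (∀ x ∈ b, 0 ≤ x) →
      (b.map fun x => 1 + x).prod ≤ c ^ b.card * Real.exp ((b.card + b.sum) / c - b.card) := by
    intro b
    induction b using Multiset.induction_on with
    | empty => simp
    | cons x b ih =>
      intro hb
      have hx : 0 ≤ x := hb x (by simp)
      have ih' := ih (fun y hy => hb y (by simp [hy]))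
      simp only [Multiset.map_cons, Multiset.prod_cons, Multiset.card_cons, Multiset.sum_cons]
      have h1 : 1 + x ≤ c * Real.exp ((1 + x) / c - 1) := by
        have := Real.add_one_le_exp ((1 + x) / c - 1)
        calc 1 + x = c * ((1 + x) / c - 1 + 1) := by field_simp; ring
          _ ≤ _ := by gcongr
      calc (1 + x) * (b.map fun x => 1 + x).prod
          ≤ (c * Real.exp ((1 + x) / c - 1)) *
            (c ^ b.card * Real.exp ((b.card + b.sum) / c - b.card)) := by
            apply mul_le_mul h1 ih' _ (by positivity)
            apply Multiset.prod_nonneg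
            intro y hy
            obtain ⟨z, hz, rfl⟩ := Multiset.mem_map.1 hy
            have := hb z (by simp [hz])
            positivity
        _ = _ := by
            rw [mul_mul_mul_comm, ← Real.exp_add, ← pow_succ']
            congr 2
            push_cast
            ring
  refine (key a ha).trans ?_
  obtain ⟨d, hd⟩ := Nat.exists_eq_add_of_le hn
  have hsum : a.sum = n * (c - 1) := by rw [hc]; field_simp; ring
  have hexp : Real.exp (((a.card : ℝ) + a.sum) / c - a.card) ≤ c ^ d := by
    have hdn : (n : ℝ) = a.card + d := by exact_mod_cast hd
    have h2 : ((a.card : ℝ) + a.sum) / c - a.card = d * (1 - c⁻¹) := by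
      rw [hsum, hdn]; field_simp; ring
    rw [h2, Real.exp_nat_mul]
    gcongr
    rw [← Real.le_log_iff_exp_le hc0]
    exact Real.one_sub_inv_le_log_of_pos hc0
  calc c ^ a.card * _ ≤ c ^ a.card * c ^ d := by gcongr
    _ = c ^ n := by rw [← pow_add, ← hd]

open Polynomial in
/-- The univariate form of the capacity inequality: a polynomial `R` of degree at most `n + 2` with
only negative roots, positive on the positive half-line, satisfies
`inf_{t > 0} R(t) / t ≤ ((n + 2) / (n + 1)) ^ (n + 1) * R'(0)`. Indeed
`R(t) = R(0) ∏ (1 + t x)` with positive `x`, which the arithmetic-geometric mean inequality bounds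
by `R(0) (1 + t S / (n + 2)) ^ (n + 2)`, where `S = ∑ x = R'(0) / R(0)`. -/
theorem Polynomial.le_mul_coeff_one {n : ℕ} {R : ℂ[X]} (hdeg : R.natDegree ≤ n + 2)
    (hd0 : R.natDegree ≠ 0)
    (hroots : ∀ r, R.eval r = 0 → ∃ s : ℝ, s < 0 ∧ r = s)
    (hpos : ∀ t : ℝ, 0 < t → 0 < R.eval (t : ℂ))
    {c : ℝ} (hc : ∀ t : ℝ, 0 < t → c * t ≤ (R.eval (t : ℂ)).re) :
    0 < R.coeff 1 ∧
      c ≤ (((n : ℝ) + 2) / ((n : ℝ) + 1)) ^ (n + 1) * (R.coeff 1).re := by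
  have hR0 : R ≠ 0 := by rintro rfl; simp at hd0
  have h0 : R.eval 0 ≠ 0 := by
    intro h
    obtain ⟨s, hs, hs'⟩ := hroots 0 h
    exact hs.ne (by exact_mod_cast hs'.symm)
  set b : Multiset ℝ := R.roots.map fun r => -(r.re)⁻¹ with hb
  have hbr : (R.roots.map fun r => -r⁻¹) = b.map (fun x : ℝ => (x : ℂ)) := by
    rw [hb, Multiset.map_map]
    apply Multiset.map_congr rfl
    intro r hr
    obtain ⟨s, hs, rfl⟩ := hroots r (isRoot_of_mem_roots hr)
    simp
  have hbpos : ∀ x ∈ b, 0 < x := by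
    intro x hx
    obtain ⟨r, hr, rfl⟩ := Multiset.mem_map.1 hx
    obtain ⟨s, hs, rfl⟩ := hroots r (isRoot_of_mem_roots hr)
    simpa using hs
  have hcard : b.card = R.natDegree := by
    rw [hb, Multiset.card_map, splits_iff_card_roots.1 (IsAlgClosed.splits R)]
  have heq := Polynomial.eq_C_mul_prod_one_add h0
  rw [hbr] at heq
  clear_value b
  set P := ((b.map (fun x : ℝ => (x : ℂ))).map fun x => 1 + C x * X).prod with hP
  have hPe : ∀ t : ℝ, P.eval (t : ℂ) = (((b.map fun x => t * x).map fun x => 1 + x).prod : ℝ) := by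
    intro t
    rw [show ((_ : ℝ) : ℂ) = _ from map_multiset_prod Complex.ofRealHom _, hP, eval_multiset_prod]
    simp only [Multiset.map_map]
    congr 1
    apply Multiset.map_congr rfl
    intro x _
    change (1 + C (x : ℂ) * X).eval (t : ℂ) = ((1 + t * x : ℝ) : ℂ)
    simp only [eval_add, eval_one, eval_mul, eval_C, eval_X]
    push_cast
    ring
  have hPpos : ∀ t : ℝ, 0 < t → 0 < ((b.map fun x => t * x).map fun x => 1 + x).prod := by
    intro t ht
    apply Multiset.prod_pos
    intro y hy
    simp only [Multiset.mem_map] at hy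
    obtain ⟨_, ⟨z, hz, rfl⟩, rfl⟩ := hy
    have := hbpos z hz
    positivity
  have hRe : ∀ t : ℂ, R.eval t = R.eval 0 * P.eval t := by
    intro t
    conv_lhs => rw [heq]
    simp
  have hR0pos : 0 < R.eval 0 := by
    have h1 := hpos 1 one_pos
    rw [hRe, hPe] at h1
    have h2 : (0 : ℂ) < (((b.map fun x => (1:ℝ) * x).map fun x => 1 + x).prod : ℝ) := by
      exact_mod_cast hPpos 1 one_pos
    exact (pos_iff_pos_of_mul_pos h1).2 h2
  obtain ⟨ρ, hρ⟩ : ∃ ρ : ℝ, R.eval 0 = ρ :=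
    ⟨(R.eval 0).re, (Complex.ext rfl (by simpa using (Complex.pos_iff.1 hR0pos).2.symm))⟩
  have hρpos : 0 < ρ := by rw [hρ] at hR0pos; exact_mod_cast hR0pos
  have hsumpos : 0 < b.sum := by
    have hne : b ≠ 0 := by
      rw [← Multiset.card_pos, hcard]; omega
    obtain ⟨x, hx⟩ := Multiset.exists_mem_of_ne_zero hne
    exact (hbpos x hx).trans_le (Multiset.single_le_sum (fun y hy => (hbpos y hy).le) x hx)
  have hcoeff : R.coeff 1 = ((ρ * b.sum : ℝ) : ℂ) := by
    conv_lhs => rw [heq]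
    rw [coeff_C_mul, hP, (Polynomial.coeff_prod_one_add_C_mul_X _).2, hρ]
    rw [Complex.ofReal_mul, show ((b.sum : ℝ) : ℂ) = _ from map_multiset_sum Complex.ofRealHom b]
    rfl
  refine ⟨by rw [hcoeff]; exact_mod_cast mul_pos hρpos hsumpos, ?_⟩
  rw [hcoeff, Complex.ofReal_re]
  -- the minimum of `(1 + t * S / (n + 2)) ^ (n + 2) / t` is attained at this `t`
  set S := b.sum
  set t : ℝ := (n + 2) / ((n + 1) * S) with ht
  have htpos : 0 < t := by positivity
  have h1 := hc t htpos
  rw [hRe, hPe, hρ, ← Complex.ofReal_mul, Complex.ofReal_re] at h1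
  have h2 : ((b.map fun x => t * x).map fun x => 1 + x).prod ≤ (1 + t * S / (n + 2)) ^ (n + 2) := by
    have := Multiset.prod_le_pow_of_sum_le (n + 2) (b.map fun x => t * x)
      (by
        intro y hy
        obtain ⟨z, hz, rfl⟩ := Multiset.mem_map.1 hy
        have := hbpos z hz
        positivity)
      (by rw [Multiset.card_map, hcard]; exact hdeg) (by omega)
    rw [Multiset.sum_map_mul_left] at this
    simpa using this
  have h3 : 1 + t * S / (n + 2) = ((n : ℝ) + 2) / (n + 1) := by
    rw [ht]; field_simp; ring
  rw [h3] at h2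
  have h4 : c * t ≤ ρ * (((n : ℝ) + 2) / (n + 1)) ^ (n + 2) :=
    h1.trans (by gcongr)
  have h5 : ρ * (((n : ℝ) + 2) / (n + 1)) ^ (n + 2) =
      ((((n : ℝ) + 2) / ((n : ℝ) + 1)) ^ (n + 1) * (ρ * S)) * t := by
    rw [ht, pow_succ _ (n + 1)]; field_simp
  rw [h5] at h4
  exact le_of_mul_le_mul_right h4 htpos

/-! ### Strictly stable homogeneous polynomials -/

/-- A complex polynomial is *strictly stable* if it has no zeros `z` with all `Re zᵢ ≥ 0` and
some `Re zᵢ > 0`. Allowing the other variables to lie on the imaginary axis, rather than asking for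
`Re zᵢ > 0` throughout, makes the notion pass to `∂p/∂x₀` at `x₀ = 0` without a limit argument. -/
def MvPolynomial.IsStrictlyStable {σ : Type*} (p : MvPolynomial σ ℂ) : Prop :=
  ∀ z : σ → ℂ, (∀ i, 0 ≤ (z i).re) → (∃ i, 0 < (z i).re) → MvPolynomial.eval z p ≠ 0

namespace MvPolynomial

/-- The univariate polynomial obtained by fixing all variables but the first one. -/
noncomputable def firstVarSlice {n : ℕ} (p : MvPolynomial (Fin (n + 1)) ℂ) (z : Fin n → ℂ) :
    Polynomial ℂ :=
  (finSuccEquiv ℂ n p).map (eval z)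

variable {n : ℕ} {p : MvPolynomial (Fin (n + 1)) ℂ} {z : Fin n → ℂ}

theorem eval_firstVarSlice (t : ℂ) :
    (firstVarSlice p z).eval t = eval (Fin.cons t z : Fin (n + 1) → ℂ) p :=
  (eval_eq_eval_mv_eval' z t p).symm

theorem coeff_firstVarSlice (i : ℕ) :
    (firstVarSlice p z).coeff i = eval z ((finSuccEquiv ℂ n p).coeff i) :=
  Polynomial.coeff_map _ _

theorem IsHomogeneous.eval_mul {σ : Type*} {p : MvPolynomial σ ℂ} {d : ℕ} (hp : p.IsHomogeneous d)
    (c : ℂ) (w : σ → ℂ) : eval (fun i => c * w i) p = c ^ d * eval w p := by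
  rw [eval_eq, eval_eq, Finset.mul_sum]
  refine Finset.sum_congr rfl fun m hm => ?_
  have hd : m.sum (fun _ e => e) = d := by
    have := hp (mem_support_iff.1 hm)
    rwa [Pi.one_def, ← Finsupp.degree_eq_weight_one] at this
  simp only [mul_pow, Finset.prod_mul_distrib]
  rw [Finset.prod_pow_eq_pow_sum, show ∑ i ∈ m.support, m i = d from hd]
  ring

theorem natDegree_firstVarSlice_le {d : ℕ} (hp : p.IsHomogeneous d) :
    (firstVarSlice p z).natDegree ≤ d := by
  refine (Polynomial.natDegree_map_le).trans ?_
  rw [natDegree_finSuccEquiv]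
  exact (degreeOf_le_totalDegree _ _).trans hp.totalDegree_le

theorem IsStrictlyStable.eval_firstVarSlice_ne_zero (hs : p.IsStrictlyStable)
    (hz : ∀ i, 0 ≤ (z i).re) (hz' : ∃ i, 0 < (z i).re) {t : ℂ} (ht : 0 ≤ t.re) :
    (firstVarSlice p z).eval t ≠ 0 := by
  rw [eval_firstVarSlice]
  obtain ⟨i, hi⟩ := hz'
  exact hs _ (Fin.cases (by simpa using ht) (by simpa using hz)) ⟨i.succ, by simpa using hi⟩

theorem IsStrictlyStable.natDegree_firstVarSlice_ne_zero {d : ℕ} (hs : p.IsStrictlyStable)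
    (hp : p.IsHomogeneous d) (hd : d ≠ 0) : (firstVarSlice p z).natDegree ≠ 0 := by
  intro h
  -- if the slice is constant, then `p (1, s z) = s ^ d p (1 / s, z)` tends to `0` with `s`
  have hconst : ∀ t, (firstVarSlice p z).eval t = (firstVarSlice p z).eval 0 := by
    intro t
    rw [Polynomial.eq_C_of_natDegree_eq_zero h]; simp
  have hcont : Continuous fun s : ℝ =>
      eval (Fin.cons 1 (fun i => (s : ℂ) * z i) : Fin (n + 1) → ℂ) p := by
    refine (MvPolynomial.continuous_eval p).comp (continuous_pi (Fin.cases ?_ fun i => ?_))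
    · simpa using continuous_const
    · simp only [Fin.cons_succ]; fun_prop
  have hlim1 := (hcont.tendsto 0).mono_left (nhdsWithin_le_nhds (s := Set.Ioi (0 : ℝ)))
  have hlim2 : Filter.Tendsto (fun s : ℝ => (s : ℂ) ^ d * (firstVarSlice p z).eval 0)
      (nhdsWithin 0 (Set.Ioi 0)) (nhds (((0 : ℝ) : ℂ) ^ d * (firstVarSlice p z).eval 0)) :=
    ((by fun_prop : Continuous fun s : ℝ => (s : ℂ) ^ d * (firstVarSlice p z).eval 0).tendsto
      0).mono_left nhdsWithin_le_nhds
  have heq : (fun s : ℝ => (s : ℂ) ^ d * (firstVarSlice p z).eval 0) =ᶠ[nhdsWithin 0 (Set.Ioi 0)]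
      fun s : ℝ => eval (Fin.cons 1 (fun i => (s : ℂ) * z i) : Fin (n + 1) → ℂ) p := by
    filter_upwards [self_mem_nhdsWithin] with s hsp
    have hs0 : (s : ℂ) ≠ 0 := by exact_mod_cast (Set.mem_Ioi.1 hsp).ne'
    rw [← hconst (s : ℂ)⁻¹, eval_firstVarSlice, ← hp.eval_mul]
    congr 2
    funext i
    refine Fin.cases ?_ (fun i => ?_) i
    · simp [hs0]
    · simp
  have := tendsto_nhds_unique (hlim1.congr' heq.symm) hlim2
  rw [Complex.ofReal_zero, zero_pow hd, zero_mul] at this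
  refine hs _ ?_ ?_ this
  · exact Fin.cases (by simp) (by simp)
  · exact ⟨0, by simp⟩

/-- Strict stability passes from `p` to `∂p/∂x₀` at `x₀ = 0`. With the other variables fixed, `p` is
a polynomial `R` in `x₀` whose roots all lie in the open left half-plane, and `R'(0) / R(0)` is the
sum of `-1 / r` over the roots `r`, hence has positive real part. -/
theorem IsStrictlyStable.coeff_one_finSuccEquiv {d : ℕ} (hs : p.IsStrictlyStable)
    (hp : p.IsHomogeneous d) (hd : d ≠ 0) :
    ((finSuccEquiv ℂ n p).coeff 1).IsStrictlyStable := by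
  intro z hz hz'
  set R := firstVarSlice p z with hR
  have hne : ∀ {t : ℂ}, 0 ≤ t.re → R.eval t ≠ 0 := fun ht =>
    hs.eval_firstVarSlice_ne_zero hz hz' ht
  have h0 : R.eval 0 ≠ 0 := hne (by simp)
  rw [← coeff_firstVarSlice, ← hR]
  have heq := Polynomial.eq_C_mul_prod_one_add h0
  have hc : R.coeff 1 = R.eval 0 * (R.roots.map fun r => -r⁻¹).sum := by
    conv_lhs => rw [heq]
    rw [Polynomial.coeff_C_mul, (Polynomial.coeff_prod_one_add_C_mul_X _).2]
  rw [hc]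
  refine mul_ne_zero h0 fun hsum => ?_
  have hroot : ∀ r ∈ R.roots, 0 < (-r⁻¹).re := by
    intro r hr
    have hr1 : r.re < 0 := by
      by_contra! h
      exact hne h (Polynomial.isRoot_of_mem_roots hr)
    rw [Complex.neg_re, Complex.inv_re, ← neg_div]
    have : 0 < Complex.normSq r := Complex.normSq_pos.2 (by rintro rfl; simp at hr1)
    exact div_pos (by linarith) this
  have hcard : 0 < R.roots.card := by
    rw [Polynomial.splits_iff_card_roots.1 (IsAlgClosed.splits R)]
    exact Nat.pos_of_ne_zero (hs.natDegree_firstVarSlice_ne_zero hp hd)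
  have hre : (R.roots.map fun r => (-r⁻¹).re).sum = 0 := by
    have := congrArg Complex.reAddGroupHom hsum
    rw [map_multiset_sum, Multiset.map_map] at this
    simpa using this
  obtain ⟨r, hr⟩ := Multiset.exists_mem_of_ne_zero (Multiset.card_pos.1 hcard)
  have h1 : (-r⁻¹).re ≤ (R.roots.map fun r => (-r⁻¹).re).sum :=
    Multiset.single_le_sum (by
      intro y hy
      obtain ⟨r, hr, rfl⟩ := Multiset.mem_map.1 hy
      exact (hroot r hr).le) _ (Multiset.mem_map_of_mem _ hr)
  exact absurd (hroot r hr) (by rw [hre] at h1; exact not_lt.2 h1)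

/-- A slice of a strictly stable homogeneous polynomial at positive values of the other variables
has only negative real roots. -/
theorem IsStrictlyStable.exists_neg_of_eval_firstVarSlice_eq_zero {d : ℕ}
    (hs : p.IsStrictlyStable) (hp : p.IsHomogeneous d) {x : Fin n → ℝ} (hx : ∀ i, 0 < x i)
    (hn : 0 < n) {r : ℂ} (hr : (firstVarSlice p fun i => (x i : ℂ)).eval r = 0) :
    ∃ s : ℝ, s < 0 ∧ r = s := by
  have hz : ∀ i, 0 ≤ ((x i : ℂ)).re := fun i => by simpa using (hx i).le
  have hz' : ∃ i, 0 < ((x i : ℂ)).re := ⟨⟨0, hn⟩, by simpa using hx _⟩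
  have hre : r.re < 0 := by
    by_contra! h
    exact hs.eval_firstVarSlice_ne_zero hz hz' h hr
  by_contra! hcon
  have him : r.im ≠ 0 := fun h => hcon r.re hre (Complex.ext rfl (by simpa using h))
  -- rotating by `w = 1 + conj r / ‖r‖` brings both `r` and the `x i` into the right half-plane
  have hr0 : r ≠ 0 := by rintro rfl; simp at hre
  have hnorm : 0 < ‖r‖ := norm_pos_iff.2 hr0
  have hlt : 0 < ‖r‖ + r.re := by
    have := Complex.abs_re_lt_norm.2 him
    have := neg_abs_le r.re
    linarith
  set w : ℂ := ‖r‖ + (starRingEnd ℂ) r with hw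
  have hwre : w.re = ‖r‖ + r.re := by simp [hw]
  have hwr : w * r = ‖r‖ * (r + ‖r‖) := by
    rw [hw, add_mul, mul_comm ((starRingEnd ℂ) r), Complex.mul_conj, Complex.normSq_eq_norm_sq]
    push_cast; ring
  rw [eval_firstVarSlice] at hr
  have := hp.eval_mul w (Fin.cons r (fun i => (x i : ℂ)))
  rw [hr, mul_zero] at this
  refine hs _ ?_ ?_ this
  · refine Fin.cases ?_ fun i => ?_
    · simp only [Fin.cons_zero]
      rw [hwr, Complex.re_ofReal_mul]
      simp only [Complex.add_re, Complex.ofReal_re]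
      exact (mul_pos hnorm (by linarith)).le
    · simp only [Fin.cons_succ]
      rw [mul_comm, Complex.re_ofReal_mul, hwre]
      exact (mul_pos (hx i) hlt).le
  · refine ⟨Fin.succ ⟨0, hn⟩, ?_⟩
    simp only [Fin.cons_succ]
    rw [mul_comm, Complex.re_ofReal_mul, hwre]
    exact mul_pos (hx _) hlt

/-- **Gurvits' capacity inequality**: a strictly stable homogeneous polynomial of degree `d` in `d`
variables with `p(x) ≥ c ∏ xᵢ` on the positive orthant has at least `c * d! / d ^ d` as its
coefficient at `∏ xᵢ`. The variables are differentiated away one at a time, the univariate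
inequality controlling the loss at each step. -/
theorem IsStrictlyStable.le_mul_coeff (n : ℕ) : ∀ {p : MvPolynomial (Fin (n + 1)) ℂ}
    (_ : p.IsStrictlyStable) (_ : p.IsHomogeneous (n + 1))
    (_ : ∀ x : Fin (n + 1) → ℝ, (∀ i, 0 < x i) → 0 < eval (fun i => (x i : ℂ)) p)
    {c : ℝ} (_ : ∀ x : Fin (n + 1) → ℝ, (∀ i, 0 < x i) →
      c * ∏ i, x i ≤ (eval (fun i => (x i : ℂ)) p).re),
    c ≤ ((n + 1 : ℕ) : ℝ) ^ (n + 1) / (n + 1).factorial *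
      (p.coeff (Finsupp.equivFunOnFinite.symm fun _ => 1)).re := by
  induction n with
  | zero =>
    intro p hs hp hpos c hc
    have h1 := hc (fun _ => 1) (fun _ => one_pos)
    have h2 : eval (fun _ => ((1 : ℝ) : ℂ)) p =
        p.coeff (Finsupp.equivFunOnFinite.symm fun _ => 1) := by
      rw [eval_eq]
      simp only [Complex.ofReal_one, one_pow, Finset.prod_const_one, mul_one]
      rw [Finset.sum_eq_single (Finsupp.equivFunOnFinite.symm fun _ => 1)]
      · intro m hm hne
        exfalso
        apply hne
        have := hp (mem_support_iff.1 hm)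
        rw [Pi.one_def, ← Finsupp.degree_eq_weight_one] at this
        ext i
        fin_cases i
        simpa [Finsupp.degree_eq_sum] using this
      · intro hm
        simpa using hm
    rw [h2] at h1
    simpa using h1
  | succ n ih =>
    intro p hs hp hpos c hc
    set q := (finSuccEquiv ℂ (n + 1) p).coeff 1 with hq
    have hqs : q.IsStrictlyStable := hs.coeff_one_finSuccEquiv hp (by omega)
    have hqh : q.IsHomogeneous (n + 1) := hp.finSuccEquiv_coeff_isHomogeneous 1 (n + 1) (by omega)
    -- `q` is `∂p/∂x₀` at `x₀ = 0`
    have hcoeff : q.coeff (Finsupp.equivFunOnFinite.symm fun _ => 1) =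
        p.coeff (Finsupp.equivFunOnFinite.symm fun _ => 1) := by
      rw [hq, finSuccEquiv_coeff_coeff]
      congr 1
      ext i
      refine Fin.cases ?_ (fun i => ?_) i <;> simp
    have step : ∀ x : Fin (n + 1) → ℝ, (∀ i, 0 < x i) →
        0 < eval (fun i => (x i : ℂ)) q ∧ c * ∏ i, x i ≤
          (((n : ℝ) + 2) / ((n : ℝ) + 1)) ^ (n + 1) * (eval (fun i => (x i : ℂ)) q).re := by
      intro x hx
      have hcons : ∀ t : ℝ, (Fin.cons (t : ℂ) (fun i => (x i : ℂ)) : Fin (n + 2) → ℂ) =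
          fun i => ((Fin.cons t x : Fin (n + 2) → ℝ) i : ℂ) := by
        intro t
        funext i
        refine Fin.cases ?_ (fun i => ?_) i <;> simp
      have hpos' : ∀ t : ℝ, 0 < t → ∀ i, 0 < (Fin.cons t x : Fin (n + 2) → ℝ) i := by
        intro t ht
        exact Fin.cases (by simpa using ht) (by simpa using hx)
      rw [hq, ← coeff_firstVarSlice]
      refine Polynomial.le_mul_coeff_one (natDegree_firstVarSlice_le hp)
        (hs.natDegree_firstVarSlice_ne_zero hp (by omega))
        (fun r hr => hs.exists_neg_of_eval_firstVarSlice_eq_zero hp hx (by omega) hr) ?_ ?_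
      · intro t ht
        rw [eval_firstVarSlice, hcons]
        exact hpos _ (hpos' t ht)
      · intro t ht
        rw [eval_firstVarSlice, hcons]
        have := hc _ (hpos' t ht)
        rw [Fin.prod_univ_succ] at this
        simp only [Fin.cons_zero, Fin.cons_succ] at this
        linarith
    have hg : (0 : ℝ) < (((n : ℝ) + 2) / ((n : ℝ) + 1)) ^ (n + 1) := by positivity
    have := ih hqs hqh (fun x hx => (step x hx).1)
      (c := c / (((n : ℝ) + 2) / ((n : ℝ) + 1)) ^ (n + 1)) (by
        intro x hx
        rw [div_mul_eq_mul_div, div_le_iff₀' hg]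
        exact (step x hx).2)
    rw [hcoeff, div_le_iff₀' hg] at this
    refine this.trans (le_of_eq ?_)
    rw [Nat.factorial_succ (n + 1), ← mul_assoc]
    congr 1
    push_cast
    have : ((n + 1).factorial : ℝ) ≠ 0 := by positivity
    rw [div_pow]
    field_simp
    ring

end MvPolynomial

/-! ### Mixed discriminants of positive semidefinite matrices -/

section MixedDiscriminant

variable {N : ℕ}

theorem mixedDiscriminant_sum {κ : Type*} [Fintype κ] [DecidableEq κ]
    (B : Fin N → κ → Matrix (Fin N) (Fin N) ℂ) :
    mixedDiscriminant (fun i => ∑ k, B i k) =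
      ∑ f : Fin N → κ, mixedDiscriminant fun i => B i (f i) := by
  simp only [mixedDiscriminant, Matrix.sum_apply, Finset.prod_univ_sum, Fintype.piFinset_univ,
    Finset.mul_sum]
  rw [Finset.sum_comm' (t' := Finset.univ) (s' := fun _ => Finset.univ) (by simp)]
  conv_rhs => rw [Finset.sum_comm]
  rw [Finset.sum_comm]
  refine Finset.sum_congr rfl fun σ _ => ?_
  rw [Finset.sum_comm]

theorem mixedDiscriminant_smul (c : Fin N → ℂ) (A : Fin N → Matrix (Fin N) (Fin N) ℂ) :
    mixedDiscriminant (fun i => c i • A i) = (∏ i, c i) * mixedDiscriminant A := by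
  simp only [mixedDiscriminant, Matrix.smul_apply, smul_eq_mul, Finset.prod_mul_distrib,
    Finset.mul_sum]
  refine Finset.sum_congr rfl fun σ _ => Finset.sum_congr rfl fun τ _ => ?_
  ring

theorem mixedDiscriminant_comp_perm (A : Fin N → Matrix (Fin N) (Fin N) ℂ)
    (π : Equiv.Perm (Fin N)) : mixedDiscriminant (A ∘ π) = mixedDiscriminant A := by
  unfold mixedDiscriminant
  rw [← Equiv.sum_comp (Equiv.mulRight π)]
  refine Finset.sum_congr rfl fun σ _ => ?_
  rw [← Equiv.sum_comp (Equiv.mulRight π)]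
  refine Finset.sum_congr rfl fun τ _ => ?_
  congr 1
  · simp only [Equiv.coe_mulRight, Equiv.Perm.sign_mul]
    rw [mul_mul_mul_comm, Int.units_mul_self, mul_one]
  · exact Equiv.prod_comp π fun i => A i (σ i) (τ i)

/-- For each `τ` the inner sum over `σ` is the Leibniz formula for `det A`. -/
theorem mixedDiscriminant_const (A : Matrix (Fin N) (Fin N) ℂ) :
    mixedDiscriminant (fun _ => A) = (N.factorial : ℂ) * A.det := by
  unfold mixedDiscriminant
  rw [Finset.sum_comm]
  have : ∀ τ : Equiv.Perm (Fin N), ∑ σ : Equiv.Perm (Fin N),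
      ((Equiv.Perm.sign (σ * τ) : ℤ) : ℂ) * ∏ i : Fin N, A (σ i) (τ i) = A.det := by
    intro τ
    rw [det_apply', ← Equiv.sum_comp (Equiv.mulRight τ)]
    refine Finset.sum_congr rfl fun σ _ => ?_
    congr 1
    · simp only [Equiv.coe_mulRight, Equiv.Perm.sign_mul]
      rw [mul_assoc, Int.units_mul_self, mul_one]
    · exact Equiv.prod_comp τ fun i => A (σ i) i
  rw [Finset.sum_congr rfl fun τ _ => this τ]
  simp [Fintype.card_perm]

/-- Polarization: the determinant of a pencil expands into mixed discriminants. -/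
theorem factorial_mul_det_sum_smul (A : Fin N → Matrix (Fin N) (Fin N) ℂ) (c : Fin N → ℂ) :
    (N.factorial : ℂ) * (∑ i, c i • A i).det =
      ∑ f : Fin N → Fin N, (∏ i, c (f i)) * mixedDiscriminant (A ∘ f) := by
  rw [← mixedDiscriminant_const, mixedDiscriminant_sum (fun _ k => c k • A k)]
  refine Finset.sum_congr rfl fun f _ => ?_
  exact mixedDiscriminant_smul (fun i => c (f i)) (A ∘ f)

theorem mixedDiscriminant_vecMulVec (v : Fin N → Fin N → ℂ) :
    mixedDiscriminant (fun i => vecMulVec (v i) (star (v i))) =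
      (Matrix.of v).det * star (Matrix.of v).det := by
  rw [← det_transpose, det_apply', star_sum, Finset.sum_mul_sum]
  unfold mixedDiscriminant
  refine Finset.sum_congr rfl fun σ _ => Finset.sum_congr rfl fun τ _ => ?_
  simp only [Equiv.Perm.sign_mul, vecMulVec_apply, Finset.prod_mul_distrib, star_mul', star_prod,
    Pi.star_apply, transpose_apply, of_apply, Units.val_mul, Int.cast_mul, star_intCast]
  ring

open scoped MatrixOrder in
theorem Matrix.PosSemidef.exists_sum_vecMulVec {n : Type*} [Fintype n] [DecidableEq n]
    {A : Matrix n n ℂ} (hA : A.PosSemidef) :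
    ∃ w : n → n → ℂ, A = ∑ k, vecMulVec (w k) (star (w k)) := by
  obtain ⟨B, hB⟩ := CStarAlgebra.nonneg_iff_eq_star_mul_self.1 hA.nonneg
  refine ⟨fun k => star (B k), ?_⟩
  rw [hB]
  ext i j
  simp [star_eq_conjTranspose, mul_apply, Matrix.sum_apply, vecMulVec_apply]

/-- The Cauchy–Binet formula for mixed discriminants: expanding each matrix into rank-one terms
writes the mixed discriminant as a sum of squared absolute values of determinants. -/
theorem mixedDiscriminant_eq_sum_det {A : Fin N → Matrix (Fin N) (Fin N) ℂ}
    {w : Fin N → Fin N → Fin N → ℂ} (hw : ∀ i, A i = ∑ k, vecMulVec (w i k) (star (w i k))) :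
    mixedDiscriminant A = ∑ f : Fin N → Fin N,
      (Matrix.of fun i => w i (f i)).det * star (Matrix.of fun i => w i (f i)).det := by
  rw [funext hw, mixedDiscriminant_sum]
  exact Finset.sum_congr rfl fun f _ => mixedDiscriminant_vecMulVec _

theorem mixedDiscriminant_nonneg {A : Fin N → Matrix (Fin N) (Fin N) ℂ}
    (hA : ∀ i, (A i).PosSemidef) : 0 ≤ mixedDiscriminant A := by
  choose w hw using fun i => (hA i).exists_sum_vecMulVec
  rw [mixedDiscriminant_eq_sum_det hw]
  exact Finset.sum_nonneg fun f _ => mul_star_self_nonneg _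

/-- Expand `M(A₁ + (B₁ - A₁), …)` multilinearly: all terms are nonnegative, and `M(A)` is one of
them. -/
theorem mixedDiscriminant_mono {A B : Fin N → Matrix (Fin N) (Fin N) ℂ}
    (hA : ∀ i, (A i).PosSemidef) (hAB : ∀ i, (B i - A i).PosSemidef) :
    mixedDiscriminant A ≤ mixedDiscriminant B := by
  have hB : B = fun i => ∑ k : Bool, (fun i (k : Bool) => if k then A i else B i - A i) i k := by
    funext i; simp
  rw [hB, mixedDiscriminant_sum]
  refine (le_of_eq ?_).trans (Finset.single_le_sum (f := fun f : Fin N → Bool =>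
    mixedDiscriminant fun i => if f i then A i else B i - A i)
    (fun f _ => mixedDiscriminant_nonneg fun i => ?_) (Finset.mem_univ fun _ => true))
  · simp
  · split_ifs
    exacts [hA i, hAB i]

/-- The case of constant tuples of `mixedDiscriminant_mono`. -/
theorem Matrix.PosSemidef.det_le_det {A B : Matrix (Fin N) (Fin N) ℂ} (hA : A.PosSemidef)
    (hAB : (B - A).PosSemidef) : A.det ≤ B.det := by
  have h := mixedDiscriminant_mono (A := fun _ => A) (B := fun _ => B) (fun _ => hA) fun _ => hAB
  rw [mixedDiscriminant_const, mixedDiscriminant_const] at h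
  have : (0 : ℂ) < N.factorial := by exact_mod_cast N.factorial_pos
  exact le_of_mul_le_mul_left h this

/-- The bijections `f` in the expansion of `N! det (∑ xᵢ Aᵢ)` contribute `N! ∏ xᵢ M(A)`; all other
terms are nonnegative. -/
theorem prod_mul_mixedDiscriminant_le_det {A : Fin N → Matrix (Fin N) (Fin N) ℂ}
    (hA : ∀ i, (A i).PosSemidef) {x : Fin N → ℝ} (hx : ∀ i, 0 ≤ x i) :
    (∏ i, (x i : ℂ)) * mixedDiscriminant A ≤ (∑ i, (x i : ℂ) • A i).det := by
  have hfac : (0 : ℂ) < N.factorial := by exact_mod_cast N.factorial_pos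
  refine le_of_mul_le_mul_left ?_ hfac
  rw [factorial_mul_det_sum_smul]
  have hinj : Function.Injective fun (π : Equiv.Perm (Fin N)) => (π : Fin N → Fin N) :=
    DFunLike.coe_injective
  calc (N.factorial : ℂ) * ((∏ i, (x i : ℂ)) * mixedDiscriminant A)
      = ∑ π : Equiv.Perm (Fin N), (∏ i, (x (π i) : ℂ)) * mixedDiscriminant (A ∘ π) := by
        have : ∀ π : Equiv.Perm (Fin N), (∏ i, (x (π i) : ℂ)) * mixedDiscriminant (A ∘ π) =
            (∏ i, (x i : ℂ)) * mixedDiscriminant A := fun π => by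
          rw [mixedDiscriminant_comp_perm, Equiv.prod_comp π fun i => (x i : ℂ)]
        rw [Finset.sum_congr rfl fun π _ => this π]
        simp [Fintype.card_perm]
    _ = ∑ f ∈ Finset.univ.map ⟨_, hinj⟩,
          (∏ i, (x (f i) : ℂ)) * mixedDiscriminant (A ∘ f) := by
        rw [Finset.sum_map]; rfl
    _ ≤ _ := by
        refine Finset.sum_le_sum_of_subset_of_nonneg (Finset.subset_univ _) fun f _ _ => ?_
        refine mul_nonneg (Finset.prod_nonneg fun i _ => by exact_mod_cast hx _) ?_
        exact mixedDiscriminant_nonneg fun i => hA _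

/-- The polynomial `det (∑ᵢ xᵢ Aᵢ)` in the variables `xᵢ`, defined by its polarized expansion into
mixed discriminants, from which the coefficient at `∏ xᵢ` can be read off. -/
noncomputable def detPencil (A : Fin N → Matrix (Fin N) (Fin N) ℂ) : MvPolynomial (Fin N) ℂ :=
  ∑ f : Fin N → Fin N,
    MvPolynomial.C (mixedDiscriminant (A ∘ f) / N.factorial) * ∏ i, MvPolynomial.X (f i)

theorem eval_detPencil (A : Fin N → Matrix (Fin N) (Fin N) ℂ) (z : Fin N → ℂ) :
    MvPolynomial.eval z (detPencil A) = (∑ i, z i • A i).det := by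
  have hfac : (N.factorial : ℂ) ≠ 0 := by exact_mod_cast N.factorial_ne_zero
  apply mul_left_cancel₀ hfac
  rw [factorial_mul_det_sum_smul, detPencil, map_sum, Finset.mul_sum]
  refine Finset.sum_congr rfl fun f _ => ?_
  simp only [map_mul, MvPolynomial.eval_C, map_prod, MvPolynomial.eval_X]
  field_simp

theorem isHomogeneous_detPencil (A : Fin N → Matrix (Fin N) (Fin N) ℂ) :
    (detPencil A).IsHomogeneous N := by
  refine MvPolynomial.IsHomogeneous.sum _ _ _ fun f _ => ?_
  have := (MvPolynomial.isHomogeneous_C (Fin N) (mixedDiscriminant (A ∘ f) / N.factorial)).mul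
    (MvPolynomial.IsHomogeneous.prod Finset.univ (fun i => (MvPolynomial.X (f i) :
      MvPolynomial (Fin N) ℂ)) (fun _ => 1) fun i _ => MvPolynomial.isHomogeneous_X _ _)
  simpa using this

theorem coeff_detPencil (A : Fin N → Matrix (Fin N) (Fin N) ℂ) :
    (detPencil A).coeff (Finsupp.equivFunOnFinite.symm fun _ => 1) = mixedDiscriminant A := by
  have hfac : (N.factorial : ℂ) ≠ 0 := by exact_mod_cast N.factorial_ne_zero
  have hinj : Function.Injective fun (π : Equiv.Perm (Fin N)) => (π : Fin N → Fin N) :=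
    DFunLike.coe_injective
  have hmon : ∀ f : Fin N → Fin N, (∏ i, MvPolynomial.X (f i) : MvPolynomial (Fin N) ℂ) =
      MvPolynomial.monomial (∑ i, Finsupp.single (f i) 1) 1 := by
    intro f
    rw [MvPolynomial.monomial_sum_one]
    rfl
  have hperm : ∀ f : Fin N → Fin N, (∑ i, Finsupp.single (f i) 1 : Fin N →₀ ℕ) =
      Finsupp.equivFunOnFinite.symm (fun _ => 1) ↔ Function.Bijective f := by
    intro f
    have happ : ∀ j, (∑ i, Finsupp.single (f i) 1 : Fin N →₀ ℕ) j =
        (Finset.univ.filter fun i => f i = j).card := by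
      intro j
      rw [Finsupp.finsetSum_apply, Finset.card_filter]
      simp [Finsupp.single_apply]
    constructor
    · intro h
      rw [← Finite.surjective_iff_bijective]
      intro j
      have hj := happ j
      rw [h] at hj
      have : (Finset.univ.filter fun i => f i = j).Nonempty := by
        rw [← Finset.card_pos, ← hj]; simp
      obtain ⟨i, hi⟩ := this
      exact ⟨i, (Finset.mem_filter.1 hi).2⟩
    · intro h
      ext j
      rw [happ]
      obtain ⟨i, rfl⟩ := h.2 j
      simp [h.1.eq_iff, Finset.filter_eq']
  rw [detPencil, MvPolynomial.coeff_sum]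
  simp only [MvPolynomial.coeff_C_mul, hmon, MvPolynomial.coeff_monomial, hperm]
  have : ∑ f : Fin N → Fin N, mixedDiscriminant (A ∘ f) / N.factorial *
      (if Function.Bijective f then (1 : ℂ) else 0) =
      ∑ f ∈ Finset.univ.map ⟨_, hinj⟩, mixedDiscriminant (A ∘ f) / N.factorial := by
    simp only [mul_ite, mul_one, mul_zero]
    rw [← Finset.sum_filter]
    refine Finset.sum_congr ?_ fun _ _ => rfl
    ext f
    simp only [Finset.mem_filter, Finset.mem_univ, true_and, Finset.mem_map,
      Function.Embedding.coeFn_mk]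
    exact ⟨fun h => ⟨Equiv.ofBijective f h, rfl⟩, by rintro ⟨π, rfl⟩; exact π.bijective⟩
  rw [this, Finset.sum_map]
  have h2 : ∀ π : Equiv.Perm (Fin N), mixedDiscriminant (A ∘ π) / N.factorial =
      mixedDiscriminant A / N.factorial := fun π => by rw [mixedDiscriminant_comp_perm]
  refine (Finset.sum_congr rfl fun π _ => h2 π).trans ?_
  simp only [Finset.sum_const, Finset.card_univ, Fintype.card_perm, Fintype.card_fin, nsmul_eq_mul]
  field_simp

/-! ### The capacity bound for mixed discriminants -/

/-- If `∑ zᵢ Aᵢ` kills `v`, then the real part `∑ Re zᵢ (v† Aᵢ v)` of `v† (∑ zᵢ Aᵢ) v` vanishes. -/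
theorem isStrictlyStable_detPencil {A : Fin N → Matrix (Fin N) (Fin N) ℂ}
    (hA : ∀ i, (A i).PosDef) : (detPencil A).IsStrictlyStable := by
  rintro z hz ⟨j, hj⟩ h
  rw [eval_detPencil] at h
  obtain ⟨v, hv, hv0⟩ := exists_mulVec_eq_zero_iff.2 h
  have h1 : (star v ⬝ᵥ ((∑ i, z i • A i) *ᵥ v)).re = 0 := by rw [hv0]; simp
  have him : ∀ i, 0 < (star v ⬝ᵥ (A i *ᵥ v)).re ∧ (star v ⬝ᵥ (A i *ᵥ v)).im = 0 := fun i => by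
    have := Complex.pos_iff.1 ((hA i).dotProduct_mulVec_pos hv)
    exact ⟨this.1, this.2.symm⟩
  have h2 : (star v ⬝ᵥ ((∑ i, z i • A i) *ᵥ v)).re =
      ∑ i, (z i).re * (star v ⬝ᵥ (A i *ᵥ v)).re := by
    rw [sum_mulVec, dotProduct_sum, Complex.re_sum]
    refine Finset.sum_congr rfl fun i _ => ?_
    rw [smul_mulVec, dotProduct_smul, smul_eq_mul, Complex.mul_re, (him i).2]
    ring
  have h3 : 0 < ∑ i, (z i).re * (star v ⬝ᵥ (A i *ᵥ v)).re :=
    Finset.sum_pos' (fun i _ => mul_nonneg (hz i) (him i).1.le)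
      ⟨j, Finset.mem_univ _, mul_pos hj (him j).1⟩
  linarith

theorem le_mixedDiscriminant_of_posDef {A : Fin N → Matrix (Fin N) (Fin N) ℂ}
    (hA : ∀ i, (A i).PosDef) {c : ℝ}
    (hc : ∀ x : Fin N → ℝ, (∀ i, 0 < x i) → c * ∏ i, x i ≤ (∑ i, (x i : ℂ) • A i).det.re) :
    c ≤ (N : ℝ) ^ N / N.factorial * (mixedDiscriminant A).re := by
  obtain _ | n := N
  · have := hc (fun _ => 1) fun _ => one_pos
    have h2 := mixedDiscriminant_const (N := 0) 0
    rw [Subsingleton.elim A fun _ => 0, h2]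
    simpa using this
  · rw [← coeff_detPencil]
    refine MvPolynomial.IsStrictlyStable.le_mul_coeff n (isStrictlyStable_detPencil hA)
      (isHomogeneous_detPencil A) (fun x hx => ?_) fun x hx => ?_
    · rw [eval_detPencil]
      refine PosDef.det_pos (posDef_sum ⟨0, Finset.mem_univ _⟩ fun i _ => (hA i).smul ?_)
      exact_mod_cast hx i
    · rw [eval_detPencil]
      exact hc x hx

theorem continuous_mixedDiscriminant :
    Continuous (mixedDiscriminant : (Fin N → Matrix (Fin N) (Fin N) ℂ) → ℂ) := by
  unfold mixedDiscriminant
  fun_prop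

/-- The lower bound for mixed discriminants of positive semidefinite tuples in terms of their
capacity. Replacing `Aᵢ` by `Aᵢ + ε` only increases `det (∑ xᵢ Aᵢ)`, so the positive definite case
applies, and `ε → 0` gives the claim. -/
theorem le_mixedDiscriminant {A : Fin N → Matrix (Fin N) (Fin N) ℂ}
    (hA : ∀ i, (A i).PosSemidef) {c : ℝ}
    (hc : ∀ x : Fin N → ℝ, (∀ i, 0 < x i) → c * ∏ i, x i ≤ (∑ i, (x i : ℂ) • A i).det.re) :
    c ≤ (N : ℝ) ^ N / N.factorial * (mixedDiscriminant A).re := by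
  have key : ∀ ε : ℝ, 0 < ε → c ≤ (N : ℝ) ^ N / N.factorial *
      (mixedDiscriminant fun i => A i + (ε : ℂ) • 1).re := by
    intro ε hε
    have hε' : (0 : ℂ) < ε := by exact_mod_cast hε
    refine le_mixedDiscriminant_of_posDef
      (fun i => PosDef.posSemidef_add (hA i) (PosDef.one.smul hε')) fun x hx => (hc x hx).trans ?_
    have hx' : ∀ i, (0 : ℂ) ≤ x i := fun i => by exact_mod_cast (hx i).le
    refine (Complex.le_def.1 (PosSemidef.det_le_det
      (posSemidef_sum _ fun i _ => (hA i).smul (hx' i)) ?_)).1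
    rw [← Finset.sum_sub_distrib]
    refine posSemidef_sum _ fun i _ => ?_
    rw [← smul_sub, add_sub_cancel_left]
    exact (PosSemidef.one.smul hε'.le).smul (hx' i)
  have hcont : Continuous fun ε : ℝ => (N : ℝ) ^ N / N.factorial *
      (mixedDiscriminant fun i => A i + (ε : ℂ) • 1).re :=
    continuous_const.mul (Complex.continuous_re.comp
      (continuous_mixedDiscriminant.comp (by fun_prop)))
  have hlim := (hcont.tendsto 0).mono_left (nhdsWithin_le_nhds (s := Set.Ioi (0 : ℝ)))
  have := ge_of_tendsto hlim (by
    filter_upwards [self_mem_nhdsWithin] with ε hε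
    exact key ε hε)
  simpa using this

/-! ### Rank conditions and positivity of mixed discriminants -/

/-- Greedy choice: `V k` is too large to lie in the span of the first `k` vectors. -/
theorem exists_linearIndependent_mem {K E : Type*} [Field K] [AddCommGroup E] [Module K E]
    [FiniteDimensional K E] : ∀ (n : ℕ) (V : Fin n → Submodule K E),
    (∀ k : Fin n, (k : ℕ) + 1 ≤ Module.finrank K (V k)) →
      ∃ w : Fin n → E, LinearIndependent K w ∧ ∀ k, w k ∈ V k := by
  intro n
  induction n with
  | zero => exact fun V _ => ⟨Fin.elim0, linearIndependent_empty_type, fun k => k.elim0⟩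
  | succ n ih =>
    intro V hV
    obtain ⟨w, hw, hwV⟩ := ih (fun k => V k.castSucc) fun k => by simpa using hV k.castSucc
    have hnot : ¬ V (Fin.last n) ≤ Submodule.span K (Set.range w) := by
      intro hle
      have h1 := Submodule.finrank_mono hle
      have h2 := hV (Fin.last n)
      rw [finrank_span_eq_card hw, Fintype.card_fin] at h1
      simp only [Fin.val_last] at h2
      omega
    obtain ⟨x, hx, hxs⟩ := SetLike.not_le_iff_exists.1 hnot
    refine ⟨Fin.snoc w x, linearIndependent_finSnoc.2 ⟨hw, hxs⟩, fun k => ?_⟩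
    refine Fin.lastCases ?_ (fun k => ?_) k
    · simpa using hx
    · simpa using hwV k

/-- A positive semidefinite matrix dominates a positive multiple of `w w†` for each `w` in its
range. With `w = B u` and `s = u† B u`, the matrix `B - s⁻¹ w w†` is the congruence of `B` by
`1 - s⁻¹ w u†`. -/
theorem Matrix.PosSemidef.exists_sub_smul_vecMulVec {n : Type*} [Fintype n] [DecidableEq n]
    {B : Matrix n n ℂ} (hB : B.PosSemidef) (u : n → ℂ) :
    ∃ c : ℝ, 0 < c ∧ (B - (c : ℂ) • vecMulVec (B *ᵥ u) (star (B *ᵥ u))).PosSemidef := by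
  have hs := hB.dotProduct_mulVec_nonneg u
  obtain ⟨s, hs'⟩ : ∃ s : ℝ, star u ⬝ᵥ (B *ᵥ u) = s :=
    ⟨_, Complex.ext rfl (by simpa using (Complex.nonneg_iff.1 hs).2.symm)⟩
  rw [hs'] at hs
  have hs0 : 0 ≤ s := by exact_mod_cast hs
  rcases hs0.eq_or_lt with h | h
  · rw [← h, Complex.ofReal_zero, hB.dotProduct_mulVec_zero_iff] at hs'
    refine ⟨1, one_pos, ?_⟩
    rw [hs']
    simpa using hB
  · refine ⟨s⁻¹, inv_pos.2 h, ?_⟩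
    have hsC : (s : ℂ) ≠ 0 := by exact_mod_cast h.ne'
    have hBu : star u ᵥ* B = star (B *ᵥ u) := by
      rw [star_mulVec, hB.1.eq]
    convert hB.mul_mul_conjTranspose_same (1 - ((s⁻¹ : ℝ) : ℂ) • vecMulVec (B *ᵥ u) (star u))
      using 1
    rw [conjTranspose_sub, conjTranspose_one, conjTranspose_smul, conjTranspose_vecMulVec,
      star_star, sub_mul, one_mul, smul_mul_assoc, vecMulVec_mul, hBu, mul_sub, mul_one, sub_mul,
      mul_smul_comm, mul_smul_comm, mul_vecMulVec, smul_mul_assoc, vecMulVec_mul_vecMulVec]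
    have h4 : star (B *ᵥ u) ⬝ᵥ u = s := by
      rw [← hBu, ← dotProduct_mulVec, hs']
    rw [h4]
    simp only [Complex.ofReal_inv, star_inv₀, Complex.star_def, Complex.conj_ofReal,
      vecMulVec_smul, smul_smul]
    rw [inv_mul_cancel₀ hsC, mul_one]
    abel

/-- The capacity of a tuple satisfying the rank condition is positive, for antitone weights. Put
`Bₖ = ∑_{i ≤ k} Aᵢ`, of rank at least `k + 1`, and choose linearly independent `wₖ ∈ range Bₖ`, so
that `Bₖ ≥ dₖ wₖ wₖ†`. Then `∑ xᵢ Aᵢ ≥ xₖ Bₖ ≥ xₖ dₖ wₖ wₖ†` for every `k`; averaging over `k`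
reduces the claim to the pencil of the `wₖ wₖ†`, whose mixed discriminant is `|det w| ^ 2 > 0`. -/
theorem exists_pos_mul_prod_le_det_of_antitone {A : Fin N → Matrix (Fin N) (Fin N) ℂ}
    (hA : ∀ i, (A i).PosSemidef) (hr : ∀ S : Finset (Fin N), S.card ≤ (∑ i ∈ S, A i).rank) :
    ∃ c : ℝ, 0 < c ∧ ∀ x : Fin N → ℝ, (∀ i, 0 < x i) → Antitone x →
      c * ∏ i, x i ≤ (∑ i, (x i : ℂ) • A i).det.re := by
  set B : Fin N → Matrix (Fin N) (Fin N) ℂ := fun k => ∑ i ∈ Finset.Iic k, A i with hBdef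
  have hB : ∀ k, (B k).PosSemidef := fun k => posSemidef_sum _ fun i _ => hA i
  obtain ⟨w, hwi, hw⟩ := exists_linearIndependent_mem N
    (fun k => LinearMap.range (B k).mulVecLin) fun k : Fin N => by
      have := hr (Finset.Iic k)
      rwa [Fin.card_Iic] at this
  choose u hu using hw
  simp only [mulVecLin_apply] at hu
  choose d hd hdB using fun k => (hB k).exists_sub_smul_vecMulVec (u k)
  simp only [hu] at hdB
  have hdet : (Matrix.of w).det ≠ 0 := by
    rw [← isUnit_iff_ne_zero, ← isUnit_iff_isUnit_det, ← linearIndependent_rows_iff_isUnit]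
    exact hwi
  set P : Fin N → Matrix (Fin N) (Fin N) ℂ := fun k => vecMulVec (w k) (star (w k)) with hP
  have hPpos : ∀ k, (P k).PosSemidef := fun k => posSemidef_vecMulVec_self_star _
  have hMP : 0 < (mixedDiscriminant P).re ∧ (mixedDiscriminant P).im = 0 := by
    rw [hP, mixedDiscriminant_vecMulVec, Complex.star_def, Complex.mul_conj]
    simpa using hdet
  rcases Nat.eq_zero_or_pos N with rfl | hN
  · exact ⟨1, one_pos, fun x _ _ => by simp⟩
  have hN' : (0 : ℝ) < N := by exact_mod_cast hN
  refine ⟨(∏ k, d k / N) * (mixedDiscriminant P).re,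
    mul_pos (Finset.prod_pos fun k _ => div_pos (hd k) hN') hMP.1, fun x hx hanti => ?_⟩
  have hy : ∀ k, 0 ≤ d k / N * x k := fun k => (mul_pos (div_pos (hd k) hN') (hx k)).le
  have h1 := prod_mul_mixedDiscriminant_le_det hPpos hy
  have h2 : (∑ k, ((d k / N * x k : ℝ) : ℂ) • P k).det ≤ (∑ i, (x i : ℂ) • A i).det := by
    refine PosSemidef.det_le_det
      (posSemidef_sum _ fun k _ => (hPpos k).smul (by exact_mod_cast hy k)) ?_
    have hk : ∀ k, (∑ i, (x i : ℂ) • A i - (x k : ℂ) • B k).PosSemidef := by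
      intro k
      have : ∑ i, (x i : ℂ) • A i - (x k : ℂ) • B k =
          ∑ i, ((if i ≤ k then x i - x k else x i : ℝ) : ℂ) • A i := by
        have hBk : (x k : ℂ) • B k = ∑ i, ((if i ≤ k then x k else 0 : ℝ) : ℂ) • A i := by
          rw [hBdef]
          simp only [Finset.smul_sum]
          rw [← Finset.sum_filter_add_sum_filter_not Finset.univ (fun i => i ≤ k)]
          rw [Finset.sum_eq_zero (s := Finset.univ.filter fun i => ¬ i ≤ k), add_zero]
          · refine Finset.sum_congr (by ext; simp) fun i hi => ?_
            rw [if_pos (Finset.mem_filter.1 hi).2]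
          · intro i hi
            rw [if_neg (Finset.mem_filter.1 hi).2]
            simp
        rw [hBk, ← Finset.sum_sub_distrib]
        refine Finset.sum_congr rfl fun i _ => ?_
        rw [← sub_smul]
        congr 1
        split_ifs <;> simp
      rw [this]
      refine posSemidef_sum _ fun i _ => (hA i).smul ?_
      split_ifs with hik
      · exact_mod_cast sub_nonneg.2 (hanti hik)
      · exact_mod_cast (hx i).le
    have hsum : ∑ i, (x i : ℂ) • A i - ∑ k, ((d k / N * x k : ℝ) : ℂ) • P k =
        ∑ k : Fin N, ((1 / N : ℝ) : ℂ) • ((∑ i, (x i : ℂ) • A i - (x k : ℂ) • B k) +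
          (x k : ℂ) • (B k - (d k : ℂ) • P k)) := by
      have hNC : (N : ℂ) ≠ 0 := by exact_mod_cast hN.ne'
      have : ∀ k : Fin N, ((1 / N : ℝ) : ℂ) • ((∑ i, (x i : ℂ) • A i - (x k : ℂ) • B k) +
          (x k : ℂ) • (B k - (d k : ℂ) • P k)) =
          ((1 / N : ℝ) : ℂ) • (∑ i, (x i : ℂ) • A i) - ((d k / N * x k : ℝ) : ℂ) • P k := by
        intro k
        rw [smul_sub (x k : ℂ), sub_add_sub_cancel, smul_sub, smul_smul, smul_smul]
        congr 2
        push_cast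
        ring
      rw [Finset.sum_congr rfl fun k _ => this k, Finset.sum_sub_distrib]
      congr 1
      rw [Finset.sum_const, Finset.card_univ, Fintype.card_fin, ← Nat.cast_smul_eq_nsmul ℂ,
        smul_smul]
      push_cast
      rw [mul_one_div_cancel hNC, one_smul]
    rw [hsum]
    refine posSemidef_sum _ fun k _ => ((hk k).add ((hdB k).smul ?_)).smul ?_
    · exact_mod_cast (hx k).le
    · exact_mod_cast (one_div_pos.2 hN').le
  have h3 := (Complex.le_def.1 (h1.trans h2)).1
  refine le_trans (le_of_eq ?_) h3
  rw [← Complex.ofReal_prod, Complex.re_ofReal_mul, Finset.prod_mul_distrib]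
  ring

/-- Sort the weights and take the smallest of the constants belonging to the finitely many
orderings. -/
theorem exists_pos_mul_prod_le_det {A : Fin N → Matrix (Fin N) (Fin N) ℂ}
    (hA : ∀ i, (A i).PosSemidef) (hr : ∀ S : Finset (Fin N), S.card ≤ (∑ i ∈ S, A i).rank) :
    ∃ c : ℝ, 0 < c ∧ ∀ x : Fin N → ℝ, (∀ i, 0 < x i) →
      c * ∏ i, x i ≤ (∑ i, (x i : ℂ) • A i).det.re := by
  have h : ∀ σ : Equiv.Perm (Fin N), _ := fun σ =>
    exists_pos_mul_prod_le_det_of_antitone (A := A ∘ σ) (fun i => hA _) fun S => by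
      have := hr (S.map σ.toEmbedding)
      rwa [Finset.card_map, Finset.sum_map] at this
  choose c hc hcx using h
  obtain ⟨σ₀, -, hσ₀⟩ := Finset.exists_min_image Finset.univ c ⟨1, Finset.mem_univ _⟩
  refine ⟨c σ₀, hc σ₀, fun x hx => ?_⟩
  set σ := Tuple.sort fun i => -x i
  have hanti : Antitone (x ∘ σ) := by
    intro i j hij
    have := Tuple.monotone_sort (fun i => -x i) hij
    simpa using this
  have h1 := hcx σ (x ∘ σ) (fun i => hx _) hanti
  rw [show ∏ i, (x ∘ σ) i = ∏ i, x i from Equiv.prod_comp σ x,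
    show ∑ i, ((x ∘ σ) i : ℂ) • (A ∘ σ) i = ∑ i, (x i : ℂ) • A i from
      Equiv.sum_comp σ fun i => (x i : ℂ) • A i] at h1
  refine le_trans ?_ h1
  exact mul_le_mul_of_nonneg_right (hσ₀ σ (Finset.mem_univ _))
    (Finset.prod_nonneg fun i _ => (hx i).le)

theorem Matrix.rank_le_rank_of_ker_le {m₁ m₂ n K : Type*} [Fintype n] [Fintype m₁] [Fintype m₂]
    [Field K] {D : Matrix m₁ n K} {Y : Matrix m₂ n K} (h : ∀ y, Y *ᵥ y = 0 → D *ᵥ y = 0) :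
    D.rank ≤ Y.rank := by
  have hle : LinearMap.ker Y.mulVecLin ≤ LinearMap.ker D.mulVecLin := fun y hy => by
    simpa using h y (by simpa using hy)
  have h1 := LinearMap.finrank_range_add_finrank_ker Y.mulVecLin
  have h2 := LinearMap.finrank_range_add_finrank_ker D.mulVecLin
  have h3 := Submodule.finrank_mono hle
  unfold Matrix.rank
  omega

/-- If `M(A) ≠ 0` and `Y` dominates a positive multiple of `Aᵢ` for each `i ∈ S`, then
`rank Y ≥ |S|`: some choice of vectors from rank-one decompositions of the `Aᵢ` is a basis, and the
kernel of `Y` is orthogonal to the members of this basis with index in `S`. -/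
theorem card_le_rank_of_mixedDiscriminant_ne_zero {A : Fin N → Matrix (Fin N) (Fin N) ℂ}
    (hA : ∀ i, (A i).PosSemidef) (hM : mixedDiscriminant A ≠ 0) {Y : Matrix (Fin N) (Fin N) ℂ}
    {S : Finset (Fin N)}
    (hY : ∀ i ∈ S, ∃ c : ℝ, 0 < c ∧ (Y - (c : ℂ) • A i).PosSemidef) :
    S.card ≤ Y.rank := by
  choose w hw using fun i => (hA i).exists_sum_vecMulVec
  rw [mixedDiscriminant_eq_sum_det hw] at hM
  obtain ⟨f, -, hf⟩ := Finset.exists_ne_zero_of_sum_ne_zero hM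
  set V : Matrix (Fin N) (Fin N) ℂ := Matrix.of fun i => star (w i (f i)) with hV
  have hdetV : V.det ≠ 0 := by
    have : V = ((Matrix.of fun i => w i (f i))ᴴ)ᵀ := by ext i j; simp [hV]
    rw [this, det_transpose, det_conjTranspose]
    exact right_ne_zero_of_mul hf
  set D : Matrix (Fin N) (Fin N) ℂ := diagonal fun i => if i ∈ S then 1 else 0 with hD
  have hrank : (D * V).rank = S.card := by
    rw [rank_mul_eq_left_of_isUnit_det _ _ (isUnit_iff_ne_zero.2 hdetV), hD, rank_diagonal]
    simp
  rw [← hrank]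
  refine rank_le_rank_of_ker_le fun y hy => ?_
  rw [← mulVec_mulVec]
  funext i
  rw [hD, mulVec_diagonal]
  by_cases hi : i ∈ S
  · obtain ⟨c, hc, hpos⟩ := hY i hi
    have h1 := (Complex.le_def.1 (hpos.dotProduct_mulVec_nonneg y)).1
    rw [sub_mulVec, hy, zero_sub, dotProduct_neg, smul_mulVec, dotProduct_smul, smul_eq_mul,
      Complex.neg_re, Complex.re_ofReal_mul, Complex.zero_re] at h1
    have h2 : (star y ⬝ᵥ (A i *ᵥ y)).re ≤ 0 := by
      by_contra! h
      have := mul_pos hc h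
      linarith
    have h3 : star y ⬝ᵥ (A i *ᵥ y) =
        ∑ k, ((Complex.normSq (star (w i k) ⬝ᵥ y) : ℝ) : ℂ) := by
      rw [hw i, sum_mulVec, dotProduct_sum]
      refine Finset.sum_congr rfl fun k _ => ?_
      rw [vecMulVec_mulVec, ← Complex.mul_conj, op_smul_eq_smul, dotProduct_smul, smul_eq_mul,
        star_dotProduct y, Complex.star_def]
    rw [h3, ← Complex.ofReal_sum, Complex.ofReal_re] at h2
    have h4 : Complex.normSq (star (w i (f i)) ⬝ᵥ y) = 0 := by
      refine le_antisymm ?_ (Complex.normSq_nonneg _)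
      exact (Finset.single_le_sum (f := fun k => Complex.normSq (star (w i k) ⬝ᵥ y))
        (fun k _ => Complex.normSq_nonneg _) (Finset.mem_univ (f i))).trans h2
    have h5 : (V *ᵥ y) i = 0 := Complex.normSq_eq_zero.1 h4
    simp [h5]
  · simp [hi]

end MixedDiscriminant

/-! ### Positive operators -/

section Operators

variable {N : ℕ} {T : Matrix (Fin N) (Fin N) ℂ →ₗ[ℂ] Matrix (Fin N) (Fin N) ℂ}

theorem Matrix.mul_diagonal_mul_conjTranspose_eq_sum (U : Matrix (Fin N) (Fin N) ℂ)
    (x : Fin N → ℂ) :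
    U * diagonal x * Uᴴ =
      ∑ i, x i • vecMulVec (fun j => U j i) (fun j => star (U j i)) := by
  ext a b
  rw [mul_apply, Matrix.sum_apply]
  refine Finset.sum_congr rfl fun i _ => ?_
  rw [mul_diagonal, conjTranspose_apply, smul_apply, vecMulVec_apply, smul_eq_mul]
  ring

theorem map_mul_diagonal_mul_conjTranspose (U : unitaryGroup (Fin N) ℂ) (x : Fin N → ℂ) :
    T ((U : Matrix (Fin N) (Fin N) ℂ) * diagonal x * (U : Matrix (Fin N) (Fin N) ℂ)ᴴ) =
      ∑ i, x i • decoheredTuple T U i := by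
  rw [mul_diagonal_mul_conjTranspose_eq_sum, map_sum]
  exact Finset.sum_congr rfl fun i _ => map_smul _ _ _

theorem Matrix.IsHermitian.eq_unitary_mul_diagonal {X : Matrix (Fin N) (Fin N) ℂ}
    (hX : X.IsHermitian) :
    X = (hX.eigenvectorUnitary : Matrix (Fin N) (Fin N) ℂ) *
      diagonal (fun i => (hX.eigenvalues i : ℂ)) *
      (hX.eigenvectorUnitary : Matrix (Fin N) (Fin N) ℂ)ᴴ := by
  conv_lhs => rw [hX.spectral_theorem, Unitary.conjStarAlgAut_apply]
  rfl

theorem decoheredTuple_posSemidef (hT : IsPositiveOperator T) (U : unitaryGroup (Fin N) ℂ)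
    (i : Fin N) : (decoheredTuple T U i).PosSemidef :=
  hT _ (posSemidef_vecMulVec_self_star _)

theorem Matrix.det_unitary_mul_mul_conjTranspose (U : unitaryGroup (Fin N) ℂ)
    (X : Matrix (Fin N) (Fin N) ℂ) :
    ((U : Matrix (Fin N) (Fin N) ℂ) * X * (U : Matrix (Fin N) (Fin N) ℂ)ᴴ).det = X.det := by
  have h : (U : Matrix (Fin N) (Fin N) ℂ)ᴴ * (U : Matrix (Fin N) (Fin N) ℂ) = 1 :=
    UnitaryGroup.star_mul_self U
  rw [det_mul_comm, ← mul_assoc, h, one_mul]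

theorem Matrix.posDef_unitary_mul_diagonal (U : unitaryGroup (Fin N) ℂ)
    {x : Fin N → ℝ} (hx : ∀ i, 0 < x i) :
    ((U : Matrix (Fin N) (Fin N) ℂ) * diagonal (fun i => (x i : ℂ)) *
      (U : Matrix (Fin N) (Fin N) ℂ)ᴴ).PosDef := by
  have hU : (U : Matrix (Fin N) (Fin N) ℂ) * (U : Matrix (Fin N) (Fin N) ℂ)ᴴ = 1 :=
    (Matrix.mem_unitaryGroup_iff).1 U.2
  refine PosDef.mul_mul_conjTranspose_same (PosDef.diagonal fun i => by exact_mod_cast hx i) ?_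
  intro v w hvw
  have := congrArg (fun y => y ᵥ* (U : Matrix (Fin N) (Fin N) ℂ)ᴴ) hvw
  simpa [vecMul_vecMul, hU] using this

theorem bddBelow_operatorCapacity (hT : IsPositiveOperator T) :
    BddBelow {c : ℝ | ∃ X : Matrix (Fin N) (Fin N) ℂ, X.PosDef ∧ X.det = 1 ∧ c = (T X).det.re} := by
  refine ⟨0, ?_⟩
  rintro c ⟨X, hX, -, rfl⟩
  exact (Complex.le_def.1 (hT X hX.posSemidef).det_nonneg).1

/-- The capacity of `T` bounds the capacity of each tuple `A_{T,U}`, in the form homogeneous in the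
weights `x`: the matrix `U diag(x / s) U†` with `s ^ N = ∏ xᵢ` has determinant `1`. -/
theorem operatorCapacity_mul_prod_le (hT : IsPositiveOperator T) (U : unitaryGroup (Fin N) ℂ)
    {x : Fin N → ℝ} (hx : ∀ i, 0 < x i) :
    operatorCapacity T * ∏ i, x i ≤ (∑ i, (x i : ℂ) • decoheredTuple T U i).det.re := by
  have hprod : 0 < ∏ i, x i := Finset.prod_pos fun i _ => hx i
  -- a positive `N`-th root of the product, also for `N = 0`
  obtain ⟨s, hs, hsN⟩ : ∃ s : ℝ, 0 < s ∧ s ^ N = ∏ i, x i := by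
    rcases Nat.eq_zero_or_pos N with rfl | hN
    · exact ⟨1, one_pos, by simp⟩
    · exact ⟨_, Real.rpow_pos_of_pos hprod _, Real.rpow_inv_natCast_pow hprod.le hN.ne'⟩
  set X := (U : Matrix (Fin N) (Fin N) ℂ) * diagonal (fun i => ((x i / s : ℝ) : ℂ)) *
    (U : Matrix (Fin N) (Fin N) ℂ)ᴴ with hX
  have hXdet : X.det = 1 := by
    rw [hX, det_unitary_mul_mul_conjTranspose, det_diagonal, ← Complex.ofReal_prod,
      Finset.prod_div_distrib, Finset.prod_const, Finset.card_univ, Fintype.card_fin, hsN,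
      div_self hprod.ne', Complex.ofReal_one]
  have hle : operatorCapacity T ≤ (T X).det.re :=
    csInf_le (bddBelow_operatorCapacity hT)
      ⟨X, posDef_unitary_mul_diagonal U fun i => div_pos (hx i) hs, hXdet, rfl⟩
  have hsum : ∑ i, (x i : ℂ) • decoheredTuple T U i = (s : ℂ) • T X := by
    rw [hX, map_mul_diagonal_mul_conjTranspose, Finset.smul_sum]
    refine Finset.sum_congr rfl fun i _ => ?_
    rw [smul_smul]
    congr 1
    push_cast
    have : (s : ℂ) ≠ 0 := by exact_mod_cast hs.ne'
    field_simp
  rw [hsum, det_smul, Fintype.card_fin, ← Complex.ofReal_pow, Complex.re_ofReal_mul, hsN, mul_comm]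
  exact mul_le_mul_of_nonneg_left hle hprod.le

theorem operatorCapacity_le (hT : IsPositiveOperator T) (U : unitaryGroup (Fin N) ℂ) :
    operatorCapacity T ≤
      (N : ℝ) ^ N / N.factorial * (mixedDiscriminant (decoheredTuple T U)).re :=
  le_mixedDiscriminant (decoheredTuple_posSemidef hT U)
    fun _ hx => operatorCapacity_mul_prod_le hT U hx

/-- Diagonalize `X = U diag(x) U†` with `∏ xᵢ = 1`; then `T X = ∑ xᵢ T(uᵢ uᵢ†)` has determinant at
least `∏ xᵢ * M(A_{T,U})`. -/
theorem le_operatorCapacity (hT : IsPositiveOperator T) {m : ℝ}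
    (hm : ∀ U, m ≤ (mixedDiscriminant (decoheredTuple T U)).re) : m ≤ operatorCapacity T := by
  refine le_csInf ⟨_, 1, PosDef.one, det_one, rfl⟩ ?_
  rintro c ⟨X, hX, hdet, rfl⟩
  set x := hX.1.eigenvalues with hx
  set U := hX.1.eigenvectorUnitary
  have heq := hX.1.eq_unitary_mul_diagonal
  have hprod : ∏ i, (x i : ℂ) = 1 := by
    rw [← hdet, hX.1.det_eq_prod_eigenvalues]; rfl
  have h1 := prod_mul_mixedDiscriminant_le_det (decoheredTuple_posSemidef hT U)
    (fun i => (hX.eigenvalues_pos i).le)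
  rw [hprod, one_mul, ← map_mul_diagonal_mul_conjTranspose, ← heq] at h1
  exact (hm U).trans (Complex.le_def.1 h1).1

theorem isCompact_unitaryGroup :
    IsCompact (unitaryGroup (Fin N) ℂ : Set (Matrix (Fin N) (Fin N) ℂ)) := by
  have hsub : (unitaryGroup (Fin N) ℂ : Set (Matrix (Fin N) (Fin N) ℂ)) ⊆
      Set.univ.pi fun _ => Set.univ.pi fun _ => Metric.closedBall (0 : ℂ) 1 := by
    intro U hU i _ j _
    rw [mem_closedBall_zero_iff]
    exact entry_norm_bound_of_unitary hU i j
  refine IsCompact.of_isClosed_subset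
    (isCompact_univ_pi fun _ => isCompact_univ_pi fun _ => isCompact_closedBall (0 : ℂ) 1) ?_ hsub
  have : (unitaryGroup (Fin N) ℂ : Set (Matrix (Fin N) (Fin N) ℂ)) =
      {U : Matrix (Fin N) (Fin N) ℂ | U * Uᴴ = 1} := by
    ext U
    exact mem_unitaryGroup_iff
  rw [this]
  exact isClosed_eq (by fun_prop) continuous_const

theorem exists_forall_mixedDiscriminant_le
    (T : Matrix (Fin N) (Fin N) ℂ →ₗ[ℂ] Matrix (Fin N) (Fin N) ℂ) :
    ∃ U₀ : unitaryGroup (Fin N) ℂ, ∀ U : unitaryGroup (Fin N) ℂ,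
      (mixedDiscriminant (decoheredTuple T U₀)).re ≤
        (mixedDiscriminant (decoheredTuple T U)).re := by
  have : CompactSpace (unitaryGroup (Fin N) ℂ) :=
    isCompact_iff_compactSpace.1 isCompact_unitaryGroup
  have hT : Continuous T := T.continuous_of_finiteDimensional
  have hcont : Continuous fun U : unitaryGroup (Fin N) ℂ =>
      (mixedDiscriminant (decoheredTuple T U)).re := by
    refine Complex.continuous_re.comp (continuous_mixedDiscriminant.comp
      (continuous_pi fun i => hT.comp ?_))
    refine continuous_matrix fun a b => ?_
    simp only [vecMulVec_apply]
    have h : ∀ a b, Continuous fun U : unitaryGroup (Fin N) ℂ =>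
      (U : Matrix (Fin N) (Fin N) ℂ) a b := fun a b => continuous_subtype_val.matrix_elem a b
    exact (h a i).mul (h b i).star
  obtain ⟨U₀, -, hU₀⟩ := isCompact_univ.exists_isMinOn ⟨1, Set.mem_univ _⟩ hcont.continuousOn
  exact ⟨U₀, fun U => hU₀ (Set.mem_univ U)⟩

/-- For a set `S` of indices, `∑_{i ∈ S} T(uᵢ uᵢ†)` is the image under `T` of a projection of rank
`|S|`, so the rank condition for positive capacity of the tuple holds. -/
theorem mixedDiscriminant_decoheredTuple_pos (hT : IsPositiveOperator T)
    (h : IsRankNonDecreasing T) (U : unitaryGroup (Fin N) ℂ) :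
    0 < (mixedDiscriminant (decoheredTuple T U)).re := by
  have hA := decoheredTuple_posSemidef hT U
  have hr : ∀ S : Finset (Fin N), S.card ≤ (∑ i ∈ S, decoheredTuple T U i).rank := by
    intro S
    set D : Matrix (Fin N) (Fin N) ℂ := diagonal fun i => if i ∈ S then 1 else 0 with hD
    have hDpos : D.PosSemidef := PosSemidef.diagonal fun i => by
      dsimp only
      split_ifs <;> simp
    have hU : IsUnit (U : Matrix (Fin N) (Fin N) ℂ).det :=
      isUnit_det_of_right_inverse (mem_unitaryGroup_iff.1 U.2)
    have hU' : IsUnit (U : Matrix (Fin N) (Fin N) ℂ)ᴴ.det := by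
      rw [det_conjTranspose]; exact hU.star
    have h1 := h _ (hDpos.mul_mul_conjTranspose_same (U : Matrix (Fin N) (Fin N) ℂ))
    rw [rank_mul_eq_left_of_isUnit_det _ _ hU', rank_mul_eq_right_of_isUnit_det _ _ hU, hD,
      map_mul_diagonal_mul_conjTranspose, rank_diagonal] at h1
    simpa using h1
  obtain ⟨c, hc, hcx⟩ := exists_pos_mul_prod_le_det hA hr
  have := hc.trans_le (le_mixedDiscriminant hA hcx)
  exact pos_of_mul_pos_right this (by positivity)

/-- Take `U` diagonalizing `X` and for `S` the set of nonzero eigenvalues `xᵢ`, so that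
`|S| = rank X` and `T X ≥ xᵢ T(uᵢ uᵢ†)` for `i ∈ S`. -/
theorem isRankNonDecreasing_of_mixedDiscriminant_ne_zero (hT : IsPositiveOperator T)
    (h : ∀ U, mixedDiscriminant (decoheredTuple T U) ≠ 0) : IsRankNonDecreasing T := by
  intro X hX
  set x := hX.1.eigenvalues with hx
  set U := hX.1.eigenvectorUnitary
  have hTX : T X = ∑ i, (x i : ℂ) • decoheredTuple T U i := by
    rw [← map_mul_diagonal_mul_conjTranspose, ← hX.1.eq_unitary_mul_diagonal]
  have hA := decoheredTuple_posSemidef hT U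
  rw [hX.1.rank_eq_card_non_zero_eigs, Fintype.card_subtype]
  refine card_le_rank_of_mixedDiscriminant_ne_zero hA (h U) fun i hi => ?_
  have hi0 : x i ≠ 0 := (Finset.mem_filter.1 hi).2
  refine ⟨x i, lt_of_le_of_ne (hX.eigenvalues_nonneg i) hi0.symm, ?_⟩
  rw [hTX, ← Finset.add_sum_erase _ _ (Finset.mem_univ i), add_sub_cancel_left]
  exact posSemidef_sum _ fun j _ => (hA j).smul (by exact_mod_cast hX.eigenvalues_nonneg j)

end Operators

/-- In the second part `IsLeast` refers to the order of `ℂ` (`z ≤ w` iff `re z ≤ re w` and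
`im z = im w`): it says that every `M(A_{T,U})` is real, that the minimum over all unitary `U`
is attained, and that it equals the real number `m`. -/
theorem lemma3p5 (N : ℕ) (T : Matrix (Fin N) (Fin N) ℂ →ₗ[ℂ] Matrix (Fin N) (Fin N) ℂ)
    (hT : IsPositiveOperator T) :
    (IsRankNonDecreasing T ↔ 0 < operatorCapacity T) ∧
    ∃ m : ℝ,
      IsLeast (Set.range fun U : Matrix.unitaryGroup (Fin N) ℂ =>
        mixedDiscriminant (decoheredTuple T U)) (m : ℂ) ∧
      m ≤ operatorCapacity T ∧
      operatorCapacity T ≤ (N : ℝ) ^ N / (Nat.factorial N : ℝ) * m := by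
  obtain ⟨U₀, hU₀⟩ := exists_forall_mixedDiscriminant_le T
  have hreal : ∀ U, mixedDiscriminant (decoheredTuple T U) =
      ((mixedDiscriminant (decoheredTuple T U)).re : ℂ) := fun U =>
    Complex.ext rfl (by simpa using (Complex.nonneg_iff.1
      (mixedDiscriminant_nonneg (decoheredTuple_posSemidef hT U))).2.symm)
  have hlow := le_operatorCapacity hT hU₀
  refine ⟨⟨fun h => (mixedDiscriminant_decoheredTuple_pos hT h U₀).trans_le hlow, fun h => ?_⟩,
    _, ⟨⟨U₀, hreal U₀⟩, ?_⟩, hlow, operatorCapacity_le hT U₀⟩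
  · refine isRankNonDecreasing_of_mixedDiscriminant_ne_zero hT fun U hU => ?_
    have := operatorCapacity_le hT U
    rw [hU, Complex.zero_re, mul_zero] at this
    exact this.not_gt h
  · rintro _ ⟨U, rfl⟩
    dsimp only
    rw [hreal U]
    exact_mod_cast hU₀ U
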